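/- Write $[M]=\{0,1,\dots,M-1\}$. The type of $x\in[M]^n$ is the multiset $\{x_1,\dots,x_n\}$ of its entries. For a partial function $f:X\to\{0,1\}$ with promise $X\subseteq[M]^n$, let $D(f)$ be the deterministic query complexity of $f$ (the least worst-case number, over inputs in $X$, of adaptive queries to entries of the input made by a deterministic decision tree that outputs $f(x)$ on every $x\in X$). Let $R(f)$ be its bounded-error randomized query complexity (the least $q$ such that some probability distribution over decision trees, each making at most $q$ queries on every $x\in X$, outputs $f(x)$ with error probability at most $1/3$ for every $x\in X$). Let $Q(f)$ be its bounded-error quantum query complexity (the least $q$ such that some quantum algorithm $U_qO_xU_{q-1}O_x\cdots U_1O_xU_0$ on a finite-dimensional space, started in a fixed basis state and ending with a measurement, outputs $f(x)$ with error probability at most $1/3$ for every $x\in X$, where the $U_j$ are unitaries independent of $x$ and $O_x$ is the query map $|i,b,w\rangle\mapsto|i,b+x_i \bmod M,w\rangle$, acting as the identity on a null index). Theorem. There is an absolute constant $c>0$ such that for all $n$ and $M$, every $T\subseteq[M]^n$ that consists of all inputs of one fixed type (equivalently, every orbit of the action of $S_n$ on $[M]^n$ by permuting the coordinates), and every $f:T\to\{0,1\}$,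 $$R(f)\ \ge\ c\,D(f)^{1/6}\qquad\text{and}\qquad Q(f)\ \ge\ c\,D(f)^{1/12}.$$ -/

import Mathlib

open scoped ENNReal NNReal

namespace QueryComplexity

/-- Inputs: strings of length `n` over the alphabet `[M] = {0, ..., M - 1}`. -/
abbrev Input (n M : ℕ) : Type := Fin n → Fin M

/-- The type of an input `x` is the multiset `{x_1, ..., x_n}` of its entries. -/
def inputType {n M : ℕ} (x : Input n M) : Multiset (Fin M) :=
  (Finset.univ : Finset (Fin n)).val.map x

/-- `T` is the set of all inputs whose type is the type of some given input. -/
def IsTypePromise {n M : ℕ} (T : Set (Input n M)) : Prop :=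
  ∃ x₀ : Input n M, T = {x | inputType x = inputType x₀}

/-! ### Deterministic algorithms -/

/-- Deterministic adaptive query algorithms: either output a bit, or query one entry of the input
and continue according to the answer. -/
inductive DecisionTree (n M : ℕ) : Type
  | output (b : Bool) : DecisionTree n M
  | query (i : Fin n) (next : Fin M → DecisionTree n M) : DecisionTree n M

namespace DecisionTree

/-- The output on input `x`. -/
def eval {n M : ℕ} : DecisionTree n M → Input n M → Bool
  | output b, _ => b
  | query i next, x => (next (x i)).eval x

/-- The number of queries made on input `x`. -/
def cost {n M : ℕ} : DecisionTree n M → Input n M → ℕ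
  | output _, _ => 0
  | query i next, x => (next (x i)).cost x + 1

end DecisionTree

/-- Some deterministic algorithm computes the partial function `f` on its whole promise `X` with
at most `q` queries on every input in `X`. -/
def DetComputable {n M : ℕ} {X : Set (Input n M)} (f : X → Bool) (q : ℕ) : Prop :=
  ∃ t : DecisionTree n M, ∀ x : X, t.eval x = f x ∧ t.cost x ≤ q

/-- The deterministic query complexity `D(f)`. -/
noncomputable def detComplexity {n M : ℕ} {X : Set (Input n M)} (f : X → Bool) : ℕ∞ :=
  ⨅ (q : ℕ) (_ : DetComputable f q), (q : ℕ∞)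

/-! ### Randomized algorithms -/

/-- Some randomized algorithm (a probability distribution over deterministic ones) computes `f`
with error probability at most `1/3` on every input in the promise `X`, never making more than
`q` queries on such an input. -/
def RandComputable {n M : ℕ} {X : Set (Input n M)} (f : X → Bool) (q : ℕ) : Prop :=
  ∃ μ : PMF (DecisionTree n M), ∀ x : X,
    μ.toOuterMeasure {t | t.eval x ≠ f x} ≤ 1 / 3 ∧ ∀ t ∈ μ.support, t.cost x ≤ q

/-- The bounded-error randomized query complexity `R(f)`. -/
noncomputable def randComplexity {n M : ℕ} {X : Set (Input n M)} (f : X → Bool) : ℕ∞ :=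
  ⨅ (q : ℕ) (_ : RandComputable f q), (q : ℕ∞)

/-! ### Quantum algorithms -/

/-- Computational basis `|i, b, w⟩`: a query index `i` (`none` is the null query), an answer
register `b ∈ [M]`, and a workspace register `w` of arbitrary finite dimension `d`. -/
abbrev QBasis (n M d : ℕ) : Type := Option (Fin n) × Fin M × Fin d

/-- The query to the input `x`, that is, the unitary map
`|i, b, w⟩ ↦ |i, b + x_i mod M, w⟩`, which does nothing for the null query.
It acts on a vector of amplitudes; subtraction in `Fin M` is modulo `M`. -/
def oracle {n M d : ℕ} (x : Input n M) (ψ : QBasis n M d → ℂ) : QBasis n M d → ℂ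
  | (none, b, w) => ψ (none, b, w)
  | (some i, b, w) => ψ (some i, b - x i, w)

/-- A quantum query algorithm: a finite-dimensional workspace, a basis state to start from,
input-independent unitaries `U 0, ..., U queries`, and the bit that is output for each outcome
of the final measurement in the computational basis. -/
structure QuantumAlgorithm (n M : ℕ) where
  queries : ℕ
  d : ℕ
  start : QBasis n M d
  U : Fin (queries + 1) → Matrix.unitaryGroup (QBasis n M d) ℂ
  out : QBasis n M d → Bool

namespace QuantumAlgorithm

/-- The state after `k` queries and the unitary that follows the last of them:
`U_k O_x U_{k-1} O_x ... U_1 O_x U_0 |start⟩`. -/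
noncomputable def stateAfter {n M : ℕ} (A : QuantumAlgorithm n M) (x : Input n M) :
    (k : ℕ) → k < A.queries + 1 → QBasis n M A.d → ℂ
  | 0, h => (A.U ⟨0, h⟩ : Matrix _ _ ℂ).mulVec (Pi.single A.start 1)
  | k + 1, h => (A.U ⟨k + 1, h⟩ : Matrix _ _ ℂ).mulVec
      (oracle x (A.stateAfter x k (Nat.lt_of_succ_lt h)))

/-- The probability that the algorithm outputs `b` on input `x`. -/
noncomputable def outputProb {n M : ℕ} (A : QuantumAlgorithm n M) (x : Input n M) (b : Bool) : ℝ :=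
  ∑ s : QBasis n M A.d,
    if A.out s = b then ‖A.stateAfter x A.queries (Nat.lt_succ_self _) s‖ ^ 2 else 0

end QuantumAlgorithm

/-- Some quantum algorithm with `q` queries computes `f` with error probability at most `1/3` on
every input in the promise `X`. -/
def QuantumComputable {n M : ℕ} {X : Set (Input n M)} (f : X → Bool) (q : ℕ) : Prop :=
  ∃ A : QuantumAlgorithm n M, A.queries = q ∧ ∀ x : X, A.outputProb x (!(f x)) ≤ 1 / 3

/-- The bounded-error quantum query complexity `Q(f)`. -/
noncomputable def quantumComplexity {n M : ℕ} {X : Set (Input n M)} (f : X → Bool) : ℕ∞ :=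
  ⨅ (q : ℕ) (_ : QuantumComputable f q), (q : ℕ∞)

end QueryComplexity

/-! A randomized or quantum algorithm with few queries is used only through its *query weights*: an
acceptance probability `p` and a weight `w x i` of each position `i` of `x`, of total at most `W`,
such that changing `x` in positions of small weight hardly changes `p`. For quantum algorithms this
is the hybrid argument of Bennett, Bernstein, Brassard and Vazirani.

Suppose first that the inputs are the permutations of `[n]`. Query weights bound the number of
disjoint blocks to which `f` is sensitive. In a minimal sensitive block every position can be
repaired by exchanging two entries; by minimality this changes `f` back, so the two positions carry
weight at least `1` together. Hence minimal blocks are small, and so are certificates. They can be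
made to avoid a small set `V` of values: if the values in `V` are hidden among many more erased
ones, then symmetry and averaging make the erased positions of `V` carry little weight, so that
block sensitivity stays bounded when changes there are free.

Certificates for opposite values of `f` contradict each other: they disagree in a position, or they
have the same value in different positions. If each new certificate avoids the values of the earlier
ones, then a certificate of the unknown input meets the queried certificates for the opposite value
each in a new position or a new value, which can happen at most `2 * C` times for certificates of
size `C`. So after `4 * C + 1` queried certificates the majority of their values is the value of
`f`.

Every input of a given type is `x₀ ∘ π` for a fixed `x₀` and some permutation `π`, and an algorithm
for permutations can be run on it by choosing the values of `π` as they are queried.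
-/

namespace QueryComplexity

/-! ### Query weights -/

section DiffSet

variable {α β : Type*} [Fintype α] [DecidableEq β]

/-- The set of positions at which `x` and `y` differ. -/
def diffSet (x y : α → β) : Finset α := {i | x i ≠ y i}

@[simp]
theorem mem_diffSet {x y : α → β} {i : α} : i ∈ diffSet x y ↔ x i ≠ y i := by simp [diffSet]

variable [DecidableEq α]

theorem diffSet_piecewise_self_subset (s : Finset α) (c x : α → β) :
    diffSet x (s.piecewise c x) ⊆ s := by
  intro i hi
  by_contra his
  simp [his] at hi

theorem diffSet_piecewise_union_subset (s t : Finset α) (c x y : α → β) :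
    diffSet ((s ∪ t).piecewise c x) (s.piecewise c y) ⊆ t ∪ diffSet x y := by
  intro i hi
  simp only [mem_diffSet, Finset.piecewise, Finset.mem_union] at hi ⊢
  grind

end DiffSet

section Certificates

variable {α β ι : Type*} [Fintype α]

/-- The values of the input `e a` at the positions in `P` force the value `f a`. -/
def IsCertificate (e : ι → α → β) (f : ι → Bool) (a : ι) (P : Finset α) : Prop :=
  ∀ b, (∀ i ∈ P, e b i = e a i) → f b = f a

/-- The block sensitivity at `e a` outside `U` is at most `N`: the positions outside `U` contain at
most `N` disjoint blocks such that some change of `e a` on `U` and one of the blocks flips the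
value. Blocks are represented by the inputs `e (b j)` that they lead to. -/
def BlockSensitivityOutsideLE [DecidableEq α] [DecidableEq β] (e : ι → α → β) (f : ι → Bool) (a : ι)
    (U : Finset α) (N : ℕ) : Prop :=
  ∀ (k : ℕ) (b : Fin k → ι), (∀ j, f (b j) ≠ f a) →
    (Pairwise fun j l => Disjoint (diffSet (e a) (e (b j)) \ U) (diffSet (e a) (e (b l)) \ U)) →
    k ≤ N

end Certificates

/-- A fractional certificate of total weight `W` for the partial function that sends the input
`e a` to `f a`. It is the common abstraction of randomized and quantum algorithms: `p x` is the
acceptance probability and `w x i` a rescaled measure of how much position `i` is queried on `x`,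
both defined off the promise too. The constants `1 / 12` and `1 / 3` let a chain of four inputs
between `e a` and `e b` contradict `separated`. -/
structure QueryWeights {α β ι : Type*} [Fintype α] [DecidableEq β]
    (e : ι → α → β) (f : ι → Bool) (W : ℕ) where
  p : (α → β) → ℝ
  w : (α → β) → α → ℝ
  nonneg : ∀ x i, 0 ≤ w x i
  sum_le : ∀ x, ∑ i, w x i ≤ W
  stable : ∀ x y, ∑ i ∈ diffSet x y, w x i < 1 → |p x - p y| < 1 / 12
  separated : ∀ a b, f a ≠ f b → 1 / 3 ≤ |p (e a) - p (e b)|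

namespace QueryWeights

variable {α β ι : Type*} [Fintype α] [DecidableEq β]
  {e : ι → α → β} {f : ι → Bool} {W : ℕ} (H : QueryWeights e f W)

include H

theorem sum_mono (x : α → β) {s t : Finset α} (h : s ⊆ t) :
    ∑ i ∈ s, H.w x i ≤ ∑ i ∈ t, H.w x i :=
  Finset.sum_le_sum_of_subset_of_nonneg h fun i _ _ => H.nonneg x i

theorem sum_finset_le (x : α → β) (s : Finset α) : ∑ i ∈ s, H.w x i ≤ W :=
  (H.sum_mono x s.subset_univ).trans (H.sum_le x)

theorem sum_pairwiseDisjoint_le {κ : Type*} [Fintype κ] (x : α → β) {B : κ → Finset α}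
    (hB : Pairwise fun j k => Disjoint (B j) (B k)) : ∑ j, ∑ i ∈ B j, H.w x i ≤ W := by
  classical
  rw [← Finset.sum_biUnion fun j _ k _ hjk => hB hjk]
  exact H.sum_finset_le x _

theorem stable_of_subset {x y : α → β} {s : Finset α} (h : diffSet x y ⊆ s)
    (hs : ∑ i ∈ s, H.w x i < 1) : |H.p x - H.p y| < 1 / 12 :=
  H.stable x y ((H.sum_mono x h).trans_lt hs)

theorem one_le_sum_diffSet {a b : ι} (h : f a ≠ f b) :
    1 ≤ ∑ i ∈ diffSet (e a) (e b), H.w (e a) i := by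
  by_contra! hlt
  linarith [H.stable _ _ hlt, H.separated a b h]

theorem pos_of_ne {a b : ι} (h : f a ≠ f b) : 0 < W := by
  exact_mod_cast one_pos.trans_le ((H.one_le_sum_diffSet h).trans (H.sum_finset_le _ _))

omit H in
/-- Pulls query weights back along a map `φ` of alphabets that carries the new inputs to old
ones. -/
def comap {γ κ : Type*} [DecidableEq γ] (H : QueryWeights e f W) (φ : γ → β) (e' : κ → α → γ)
    (r : κ → ι) (hr : ∀ k, e (r k) = φ ∘ e' k) : QueryWeights e' (f ∘ r) W where
  p x := H.p (φ ∘ x)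
  w x := H.w (φ ∘ x)
  nonneg x := H.nonneg _
  sum_le x := H.sum_le _
  stable x y h := by
    refine H.stable_of_subset (fun i hi => ?_) h
    simp only [mem_diffSet, Function.comp_apply] at hi ⊢
    exact fun hxy => hi (congrArg φ hxy)
  separated a b h := by
    rw [← hr, ← hr]
    exact H.separated _ _ h

section Hybrid

variable [DecidableEq α]

/- Four small changes lead from `e a` to `e b`: overwrite `e a` on `E`, then also on `U`, undo the
overwriting on `U` while passing to `e b`, and undo the overwriting on `E`. The two middle steps are
governed by the weights of the same input, overwritten on `E ∪ U`. -/
theorem one_le_sum_piecewise (c : α → β) (E U : Finset α) {a b : ι} (h : f a ≠ f b) :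
    1 ≤ ∑ i ∈ E, H.w (e a) i + ∑ i ∈ E, H.w (e b) i
      + ∑ i ∈ U, H.w ((E ∪ U).piecewise c (e a)) i
      + ∑ i ∈ diffSet (e a) (e b) \ U, H.w ((E ∪ U).piecewise c (e a)) i := by
  set z := (E ∪ U).piecewise c (e a)
  by_contra! hlt
  have nonneg (x : α → β) (s : Finset α) : 0 ≤ ∑ i ∈ s, H.w x i :=
    Finset.sum_nonneg fun i _ => H.nonneg x i
  have hEa := nonneg (e a) E
  have hEb := nonneg (e b) E
  have hU := nonneg z U
  have hd := nonneg z (diffSet (e a) (e b) \ U)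
  have overwrite_a : |H.p (e a) - H.p (E.piecewise c (e a))| < 1 / 12 :=
    H.stable_of_subset (diffSet_piecewise_self_subset E c (e a)) (by linarith)
  have overwrite_b : |H.p (e b) - H.p (E.piecewise c (e b))| < 1 / 12 :=
    H.stable_of_subset (diffSet_piecewise_self_subset E c (e b)) (by linarith)
  have restore_a : |H.p z - H.p (E.piecewise c (e a))| < 1 / 12 := by
    refine H.stable_of_subset (diffSet_piecewise_union_subset E U c (e a) (e a)) ?_
    rw [show diffSet (e a) (e a) = ∅ by simp [diffSet], Finset.union_empty]
    linarith
  have restore_b : |H.p z - H.p (E.piecewise c (e b))| < 1 / 12 := by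
    refine H.stable_of_subset (diffSet_piecewise_union_subset E U c (e a) (e b)) ?_
    rw [← Finset.union_sdiff_self_eq_union, Finset.sum_union Finset.disjoint_sdiff]
    linarith
  refine (H.separated a b h).not_gt ?_
  rw [abs_lt] at *
  constructor <;> linarith

end Hybrid
end QueryWeights

theorem le_three_mul_of_average {k W C L : ℝ} (hk : 0 ≤ k) (hW : 0 ≤ W)
    (hL : L = 6 * W + 1) (hC : (3 * W + 1) * C ≤ L * W)
    (hcount : L * k ≤ k * W + k * W + k * C + L * W) : k ≤ 3 * W := by
  have hC' : C ≤ L / 3 := by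
    refine le_of_mul_le_mul_left ?_ (show 0 < 3 * W + 1 by linarith)
    subst hL
    nlinarith
  have hgap : L / 3 ≤ L - 2 * W - C := by linarith
  have : L * (k / 3) ≤ L * W := by nlinarith [mul_le_mul_of_nonneg_left hgap hk]
  linarith [le_of_mul_le_mul_left this (by linarith)]

namespace QueryWeights

variable {α β ι : Type*} [Fintype α] [DecidableEq β]
  {e : ι → α → β} {f : ι → Bool} {W : ℕ} (H : QueryWeights e f W)

include H

theorem blockSensitivityOutsideLE_empty [DecidableEq α] (a : ι) :
    BlockSensitivityOutsideLE e f a ∅ W := by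
  intro k b hb hdisj
  simp only [Finset.sdiff_empty] at hdisj
  have hk : (k : ℝ) ≤ ∑ j, ∑ i ∈ diffSet (e a) (e (b j)), H.w (e a) i := by
    simpa using Finset.card_nsmul_le_sum Finset.univ _ 1
      fun j _ => H.one_le_sum_diffSet (hb j).symm
  exact_mod_cast hk.trans (H.sum_pairwiseDisjoint_le (e a) hdisj)

theorem blockSensitivityOutsideLE_of_average [DecidableEq α] (c : α → β) {L : ℕ}
    (hL : L = 6 * W + 1) (a : ι) (U : Finset α) (E : Fin L → Finset α)
    (hE : Pairwise fun l l' => Disjoint (E l) (E l'))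
    (hU : (3 * W + 1) * ∑ l, ∑ i ∈ U, H.w ((E l ∪ U).piecewise c (e a)) i ≤ L * W) :
    BlockSensitivityOutsideLE e f a U (3 * W) := by
  intro k b hb hdisj
  set A : Fin L → ℝ := fun l => ∑ i ∈ E l, H.w (e a) i
  set B : Fin L → Fin k → ℝ := fun l j => ∑ i ∈ E l, H.w (e (b j)) i
  set C : Fin L → ℝ := fun l => ∑ i ∈ U, H.w ((E l ∪ U).piecewise c (e a)) i
  set D : Fin L → Fin k → ℝ := fun l j =>
    ∑ i ∈ diffSet (e a) (e (b j)) \ U, H.w ((E l ∪ U).piecewise c (e a)) i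
  have hA : k * ∑ l, A l ≤ k * W := by gcongr; exact H.sum_pairwiseDisjoint_le _ hE
  have hB : ∑ l, ∑ j, B l j ≤ k * W := by
    rw [Finset.sum_comm]
    simpa using Finset.sum_le_card_nsmul Finset.univ (fun j => ∑ l, B l j) W
      fun j _ => H.sum_pairwiseDisjoint_le _ hE
  have hD : ∑ l, ∑ j, D l j ≤ L * W := by
    simpa using Finset.sum_le_card_nsmul Finset.univ (fun l => ∑ j, D l j) W
      fun l _ => H.sum_pairwiseDisjoint_le _ hdisj
  have hcount : (L * k : ℝ) ≤ ∑ l, ∑ j, (A l + B l j + C l + D l j) := by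
    have h := Finset.sum_le_sum fun l (_ : l ∈ Finset.univ) =>
      Finset.sum_le_sum fun j (_ : j ∈ Finset.univ) =>
        H.one_le_sum_piecewise c (E l) U (hb j).symm
    simpa using h
  simp only [Finset.sum_add_distrib, Finset.sum_const, Finset.card_univ, Fintype.card_fin,
    nsmul_eq_mul, ← Finset.mul_sum] at hcount
  have := le_three_mul_of_average (k := k) (W := W) (C := ∑ l, C l) (L := L) k.cast_nonneg
    W.cast_nonneg (mod_cast hL) hU (by linarith)
  exact_mod_cast this

end QueryWeights

/-! ### Certificates of permutations -/

namespace QueryWeights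

section Perm

open Equiv (Perm)

variable {α : Type*} [Fintype α] [DecidableEq α] {f : Perm α → Bool} {W : ℕ}
  (H : QueryWeights (fun π : Perm α => ⇑π) f W)

include H

theorem one_le_add_of_apply_ne {y y' : Perm α} {a b : α} (hab : a ≠ b) (h : f y' ≠ f y)
    (heq : ∀ c, c ≠ a → c ≠ b → y' c = y c) : 1 ≤ H.w y a + H.w y b := by
  rw [← Finset.sum_pair hab]
  refine (H.one_le_sum_diffSet h.symm).trans (H.sum_mono _ fun c hc => ?_)
  by_contra hcab
  simp only [Finset.mem_insert, Finset.mem_singleton, not_or] at hcab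
  exact mem_diffSet.mp hc (heq c hcab.1 hcab.2).symm

theorem one_le_add_of_minimal {x y : Perm α} {U : Finset α} (hxy : f y ≠ f x)
    (hmin : ∀ y' : Perm α, f y' ≠ f x → ¬ diffSet x y' \ U ⊂ diffSet x y \ U) {a : α}
    (ha : a ∈ diffSet x y \ U) : 1 ≤ H.w y a + H.w y (y.symm (x a)) := by
  have hxa : x a ≠ y a := mem_diffSet.mp (Finset.mem_sdiff.mp ha).1
  set b := y.symm (x a)
  have hyb : y b = x a := y.apply_symm_apply (x a)
  have hab : a ≠ b := fun h => hxa (by rw [← hyb, ← h])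
  -- Repair `y` at `a` by exchanging its entries at `a` and `b`.
  set y' : Perm α := (Equiv.swap a b).trans y
  have hy'a : y' a = x a := by simp [y', hyb]
  have hy' (c : α) (hca : c ≠ a) (hcb : c ≠ b) : y' c = y c := by
    simp [y', Equiv.swap_apply_of_ne_of_ne hca hcb]
  have hsub : diffSet x y' \ U ⊂ diffSet x y \ U := by
    refine (Finset.ssubset_iff_of_subset fun c hc => ?_).mpr ⟨a, ha, by simp [hy'a]⟩
    rw [Finset.mem_sdiff, mem_diffSet] at hc ⊢
    refine ⟨?_, hc.2⟩
    by_cases hca : c = a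
    · rwa [hca]
    by_cases hcb : c = b
    · rw [hcb, hyb]
      exact fun h => hab.symm (x.injective h)
    · rw [← hy' c hca hcb]
      exact hc.1
  have hfy' : f y' = f x := by
    by_contra h
    exact hmin y' h hsub
  exact H.one_le_add_of_apply_ne hab (by rw [hfy']; exact hxy.symm) hy'

theorem card_diffSet_sdiff_le_of_minimal {x y : Perm α} {U : Finset α} (hxy : f y ≠ f x)
    (hmin : ∀ y' : Perm α, f y' ≠ f x → ¬ diffSet x y' \ U ⊂ diffSet x y \ U) :
    (diffSet x y \ U).card ≤ 2 * W := by
  set B := diffSet x y \ U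
  have hsum : (B.card : ℝ) ≤ ∑ a ∈ B, H.w y a + ∑ a ∈ B, H.w y (y.symm (x a)) := by
    rw [← Finset.sum_add_distrib]
    simpa using Finset.card_nsmul_le_sum B _ 1 fun a ha => H.one_le_add_of_minimal hxy hmin ha
  have himage : ∑ a ∈ B, H.w y (y.symm (x a)) ≤ W := by
    simpa using H.sum_finset_le y (B.map (x.trans y.symm).toEmbedding)
  have : (B.card : ℝ) ≤ ((2 * W : ℕ) : ℝ) := by
    push_cast
    linarith [H.sum_finset_le y B]
  exact_mod_cast this

theorem exists_diffSet_sdiff_subset_card_le {x y : Perm α} (U : Finset α) (hxy : f y ≠ f x) :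
    ∃ z : Perm α, f z ≠ f x ∧ diffSet x z \ U ⊆ diffSet x y \ U ∧
      (diffSet x z \ U).card ≤ 2 * W := by
  obtain ⟨z, ⟨hzf, hzy⟩, hzmin⟩ := (measure fun z : Perm α => (diffSet x z \ U).card).wf.has_min
    {z | f z ≠ f x ∧ diffSet x z \ U ⊆ diffSet x y \ U} ⟨y, hxy, subset_rfl⟩
  refine ⟨z, hzf, hzy, H.card_diffSet_sdiff_le_of_minimal hzf fun y' hy' hlt => ?_⟩
  exact hzmin y' ⟨hy', hlt.1.trans hzy⟩ (Finset.card_lt_card hlt)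

theorem exists_disjoint_blocks {x : Perm α} {U : Finset α} {N : ℕ}
    (hN : BlockSensitivityOutsideLE (fun π : Perm α => ⇑π) f x U N)
    (hno : ∀ P : Finset α, Disjoint P U → P.card ≤ N * (2 * W) →
      ¬ IsCertificate (fun π : Perm α => ⇑π) f x P) (k : ℕ) :
    ∃ y : Fin k → Perm α, (∀ j, f (y j) ≠ f x) ∧
      (Pairwise fun i j => Disjoint (diffSet x (y i) \ U) (diffSet x (y j) \ U)) ∧
      ∀ j, (diffSet x (y j) \ U).card ≤ 2 * W := by
  induction k with
  | zero => exact ⟨Fin.elim0, fun j => j.elim0, fun j => j.elim0, fun j => j.elim0⟩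
  | succ k ih =>
    obtain ⟨y, hy, hdisj, hcard⟩ := ih
    set P := Finset.univ.biUnion fun j => diffSet x (y j) \ U
    have hPU : Disjoint P U :=
      (Finset.disjoint_biUnion_left _ _ _).mpr fun j _ => Finset.sdiff_disjoint
    have hPcard : P.card ≤ N * (2 * W) :=
      calc P.card ≤ (Finset.univ : Finset (Fin k)).card * (2 * W) :=
            Finset.card_biUnion_le_card_mul _ _ _ fun j _ => hcard j
        _ ≤ N * (2 * W) := by
            rw [Finset.card_univ, Fintype.card_fin]
            exact Nat.mul_le_mul_right _ (hN k y hy hdisj)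
    have hPno := hno P hPU hPcard
    simp only [IsCertificate, not_forall] at hPno
    obtain ⟨y₀, hy₀P, hy₀⟩ := hPno
    obtain ⟨z, hz, hzy₀, hzcard⟩ := H.exists_diffSet_sdiff_subset_card_le U hy₀
    have hzdisj (j : Fin k) : Disjoint (diffSet x z \ U) (diffSet x (y j) \ U) := by
      refine Finset.disjoint_left.mpr fun i hiz hij => ?_
      have hi := mem_diffSet.mp (Finset.mem_sdiff.mp (hzy₀ hiz)).1
      exact hi (hy₀P i (Finset.mem_biUnion.mpr ⟨j, Finset.mem_univ _, hij⟩)).symm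
    refine ⟨Fin.cons z y, ?_, ?_, ?_⟩
    · simpa [Fin.forall_fin_succ] using ⟨hz, hy⟩
    · simp only [Pairwise, Fin.forall_fin_succ, Fin.cons_zero, Fin.cons_succ, ne_eq,
        not_true_eq_false, false_imp_iff, true_and, Fin.succ_inj]
      exact ⟨fun j _ => hzdisj j, fun i => ⟨fun _ => (hzdisj i).symm, fun j hij => hdisj hij⟩⟩
    · simpa [Fin.forall_fin_succ] using ⟨hzcard, hcard⟩

theorem exists_isCertificate_disjoint {x : Perm α} {U : Finset α} {N : ℕ}
    (hN : BlockSensitivityOutsideLE (fun π : Perm α => ⇑π) f x U N) :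
    ∃ P : Finset α, Disjoint P U ∧ P.card ≤ N * (2 * W) ∧
      IsCertificate (fun π : Perm α => ⇑π) f x P := by
  by_contra! hno
  obtain ⟨y, hy, hdisj, -⟩ := H.exists_disjoint_blocks hN hno (N + 1)
  exact (hN _ y hy hdisj).not_gt (Nat.lt_succ_self N)

theorem exists_isCertificate (x : Perm α) :
    ∃ P : Finset α, P.card ≤ W * (2 * W) ∧ IsCertificate (fun π : Perm α => ⇑π) f x P := by
  obtain ⟨P, -, hP⟩ := H.exists_isCertificate_disjoint (H.blockSensitivityOutsideLE_empty x)
  exact ⟨P, hP⟩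

end Perm
end QueryWeights

section Masking

open Equiv (Perm)

variable {α : Type*}

theorem exists_pairwise_disjoint_card_eq [Fintype α] (A : Finset α) {L k : ℕ}
    (h : A.card + L * k ≤ Fintype.card α) :
    ∃ V : Fin L → Finset α, (∀ l, (V l).card = k) ∧ (∀ l, Disjoint (V l) A) ∧
      Pairwise fun l l' => Disjoint (V l) (V l') := by
  classical
  have hcard : Fintype.card (Fin L × Fin k) ≤ Fintype.card {a // a ∉ A} := by
    rw [Fintype.card_subtype_compl, Fintype.card_coe, Fintype.card_prod, Fintype.card_fin,
      Fintype.card_fin]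
    omega
  obtain ⟨φ⟩ := Function.Embedding.nonempty_of_card_le hcard
  refine ⟨fun l => Finset.univ.map ⟨fun u => (φ (l, u) : α), fun u u' huu' => ?_⟩, ?_, ?_, ?_⟩
  · simpa using φ.injective (Subtype.ext huu')
  · simp
  · intro l
    simp only [Finset.disjoint_left, Finset.mem_map, Finset.mem_univ, true_and]
    rintro _ ⟨u, rfl⟩
    exact (φ (l, u)).2
  · intro l l' hll'
    simp only [Finset.disjoint_left, Finset.mem_map, Finset.mem_univ, true_and]
    rintro _ ⟨u, rfl⟩ ⟨u', huu'⟩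
    exact hll' (Prod.ext_iff.mp (φ.injective (Subtype.ext huu'))).1.symm

/-- The positions at which the permutation `z` takes a value in `V`. -/
def positions (z : Perm α) (V : Finset α) : Finset α := V.map z.symm.toEmbedding

@[simp]
theorem mem_positions {z : Perm α} {V : Finset α} {i : α} : i ∈ positions z V ↔ z i ∈ V := by
  simp [positions]

theorem sum_positions {M : Type*} [AddCommMonoid M] (z : Perm α) (V : Finset α) (g : α → M) :
    ∑ i ∈ positions z V, g i = ∑ v ∈ V, g (z.symm v) := by simp [positions]

variable [DecidableEq α]

/-- The permutation `z` with the values in `R` erased: each of them is replaced by its position,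
so that the result does not depend on how the values in `R` are arranged. -/
def mask (R : Finset α) (z : Perm α) : α → α := (positions z R).piecewise id z

theorem mask_union (R R' : Finset α) (z : Perm α) :
    mask (R ∪ R') z = (positions z R ∪ positions z R').piecewise id z := by
  funext i
  simp only [mask, Finset.piecewise, Finset.mem_union, mem_positions]

theorem mask_swap_mul {R : Finset α} {v v' : α} (hv : v ∈ R) (hv' : v' ∈ R) (z : Perm α) :
    mask R (Equiv.swap v v' * z) = mask R z := by
  funext i
  simp only [mask, Finset.piecewise, mem_positions, Perm.mul_apply, Equiv.swap_apply_def]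
  grind

variable [Fintype α]

/-- The permutations that agree with `a` on `S`. -/
def agreeing (a : Perm α) (S : Finset α) : Finset (Perm α) := {z | ∀ i ∈ S, z i = a i}

@[simp]
theorem mem_agreeing {a z : Perm α} {S : Finset α} : z ∈ agreeing a S ↔ ∀ i ∈ S, z i = a i := by
  simp [agreeing]

theorem self_mem_agreeing (a : Perm α) (S : Finset α) : a ∈ agreeing a S := by simp

theorem swap_mul_mem_agreeing {a z : Perm α} {S : Finset α} {v v' : α} (hv : v ∉ S.image a)
    (hv' : v' ∉ S.image a) : Equiv.swap v v' * z ∈ agreeing a S ↔ z ∈ agreeing a S := by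
  simp only [Finset.mem_image, not_exists, not_and] at hv hv'
  simp only [mem_agreeing, Perm.mul_apply]
  refine forall₂_congr fun i hi => ?_
  rw [Equiv.swap_apply_eq_iff, Equiv.swap_apply_of_ne_of_ne (hv i hi) (hv' i hi)]

theorem sum_agreeing_mask_eq {M : Type*} [AddCommMonoid M] (g : (α → α) → α → M) (a : Perm α)
    {S R : Finset α} (hR : Disjoint R (S.image a)) {v v' : α} (hv : v ∈ R) (hv' : v' ∈ R) :
    ∑ z ∈ agreeing a S, g (mask R z) (z.symm v)
      = ∑ z ∈ agreeing a S, g (mask R z) (z.symm v') := by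
  refine Finset.sum_equiv (Equiv.mulLeft (Equiv.swap v v')) (fun z => ?_) fun z _ => ?_
  · rw [Equiv.coe_mulLeft, swap_mul_mem_agreeing (Finset.disjoint_left.mp hR hv)
      (Finset.disjoint_left.mp hR hv')]
  · rw [Equiv.coe_mulLeft, mask_swap_mul hv hv']
    congr 1
    simp [Perm.mul_def]

end Masking

namespace QueryWeights

section Perm

open Equiv (Perm)

variable {α : Type*} [Fintype α] [DecidableEq α] {f : Perm α → Bool} {W : ℕ}
  (H : QueryWeights (fun π : Perm α => ⇑π) f W)

include H

theorem card_mul_sum_agreeing_mask_le (a : Perm α) {S R V : Finset α}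
    (hR : Disjoint R (S.image a)) (hV : V ⊆ R) :
    R.card * ∑ z ∈ agreeing a S, ∑ i ∈ positions z V, H.w (mask R z) i
      ≤ V.card * ((agreeing a S).card * W) := by
  set s : α → ℝ := fun v => ∑ z ∈ agreeing a S, H.w (mask R z) (z.symm v)
  have hs (v : α) (hv : v ∈ V) : R.card * s v ≤ (agreeing a S).card * W :=
    calc R.card * s v = ∑ v' ∈ R, s v' := by
          rw [← nsmul_eq_mul, ← Finset.sum_const]
          exact Finset.sum_congr rfl fun v' hv' => sum_agreeing_mask_eq H.w a hR (hV hv) hv'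
      _ = ∑ z ∈ agreeing a S, ∑ i ∈ positions z R, H.w (mask R z) i := by
          rw [Finset.sum_comm]
          simp only [sum_positions]
      _ ≤ (agreeing a S).card * W := by
          rw [← nsmul_eq_mul]
          exact Finset.sum_le_card_nsmul _ _ _ fun z _ => H.sum_finset_le _ _
  calc R.card * ∑ z ∈ agreeing a S, ∑ i ∈ positions z V, H.w (mask R z) i
      = ∑ v ∈ V, R.card * s v := by
        simp only [sum_positions]
        rw [Finset.sum_comm, Finset.mul_sum]
    _ ≤ V.card * ((agreeing a S).card * W) := by
        rw [← nsmul_eq_mul]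
        exact Finset.sum_le_card_nsmul _ _ _ hs

theorem mul_sum_agreeing_mask_le (a : Perm α) {S R V : Finset α} {m : ℕ}
    (hR : Disjoint R (S.image a)) (hV : V ⊆ R) (hcard : R.card = m * V.card) :
    m * ∑ z ∈ agreeing a S, ∑ i ∈ positions z V, H.w (mask R z) i
      ≤ (agreeing a S).card * W := by
  obtain rfl | hne := V.eq_empty_or_nonempty
  · simp only [sum_positions, Finset.sum_empty, Finset.sum_const_zero, mul_zero]
    positivity
  · refine le_of_mul_le_mul_left ?_ (show (0 : ℝ) < V.card by exact_mod_cast hne.card_pos)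
    have h := H.card_mul_sum_agreeing_mask_le a hR hV
    rwa [hcard, Nat.cast_mul, mul_comm (m : ℝ), mul_assoc] at h

theorem exists_agreeing_blockSensitivityOutsideLE (a : Perm α) {S V : Finset α}
    (hV : Disjoint V (S.image a))
    (hcard : S.card + V.card * (1 + (6 * W + 1) * (3 * W)) ≤ Fintype.card α) :
    ∃ z ∈ agreeing a S,
      BlockSensitivityOutsideLE (fun π : Perm α => ⇑π) f z (positions z V) (3 * W) := by
  set L := 6 * W + 1 with hL
  obtain ⟨B, hBcard, hBdisj, hB⟩ := exists_pairwise_disjoint_card_eq (V ∪ S.image a)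
    (L := L) (k := 3 * W * V.card) <| by
      rw [Finset.card_union_of_disjoint hV, Finset.card_image_of_injective _ a.injective]
      linarith
  have hR (l : Fin L) : Disjoint (B l ∪ V) (S.image a) :=
    Finset.disjoint_union_left.mpr ⟨(Finset.disjoint_union_right.mp (hBdisj l)).2, hV⟩
  have hRcard (l : Fin L) : (B l ∪ V).card = (3 * W + 1) * V.card := by
    rw [Finset.card_union_of_disjoint (Finset.disjoint_union_right.mp (hBdisj l)).1, hBcard]
    ring
  have haverage : ∑ z ∈ agreeing a S,
        (3 * W + 1) * ∑ l, ∑ i ∈ positions z V, H.w (mask (B l ∪ V) z) i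
      ≤ ∑ _z ∈ agreeing a S, (L * W : ℝ) := by
    have h := Finset.sum_le_sum fun l (_ : l ∈ Finset.univ) =>
      H.mul_sum_agreeing_mask_le a (hR l) Finset.subset_union_right (hRcard l)
    rw [← Finset.mul_sum, Finset.sum_comm, Finset.mul_sum] at h
    push_cast at h
    refine h.trans_eq ?_
    simp only [Finset.sum_const, Finset.card_univ, Fintype.card_fin, nsmul_eq_mul]
    ring
  obtain ⟨z, hz, hzle⟩ := Finset.exists_le_of_sum_le ⟨a, self_mem_agreeing a S⟩ haverage
  refine ⟨z, hz, H.blockSensitivityOutsideLE_of_average id hL z (positions z V)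
    (fun l => positions z (B l)) (fun l l' hll' => (Finset.disjoint_map _).mpr (hB hll')) ?_⟩
  simpa only [mask_union] using hzle

theorem exists_agreeing_isCertificate (a : Perm α) (S V : Finset α)
    (hcard : S.card + V.card * (1 + (6 * W + 1) * (3 * W)) ≤ Fintype.card α) :
    ∃ z ∈ agreeing a S, ∃ P : Finset α, P.card ≤ 3 * W * (2 * W) ∧
      IsCertificate (fun π : Perm α => ⇑π) f z P ∧ ∀ i ∈ P, z i ∈ V → i ∈ S := by
  have hcard' : S.card + (V \ S.image a).card * (1 + (6 * W + 1) * (3 * W)) ≤ Fintype.card α :=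
    hcard.trans' (by gcongr; exact Finset.sdiff_subset)
  obtain ⟨z, hz, hbs⟩ := H.exists_agreeing_blockSensitivityOutsideLE a Finset.sdiff_disjoint hcard'
  obtain ⟨P, hPU, hPcard, hP⟩ := H.exists_isCertificate_disjoint hbs
  refine ⟨z, hz, P, hPcard, hP, fun i hi hzi => ?_⟩
  have hziS : z i ∈ S.image a := by
    by_contra h
    exact Finset.disjoint_left.mp hPU hi (mem_positions.mpr (Finset.mem_sdiff.mpr ⟨hzi, h⟩))
  obtain ⟨j, hj, hji⟩ := Finset.mem_image.mp hziS
  rwa [← z.injective ((mem_agreeing.mp hz j hj).trans hji)]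

end Perm
end QueryWeights

/-! ### The decision tree -/

namespace DecisionTree

variable {n M : ℕ} {ι : Type*} {e : ι → Input n M} {f : ι → Bool}

/-- The tree `t` outputs `f a` after at most `q` queries on the input `e a`, for every `a` in
`s`. Indexing the promise by `ι` allows it to be the set of all permutations. -/
def Computes (t : DecisionTree n M) (e : ι → Input n M) (f : ι → Bool) (s : Set ι) (q : ℕ) : Prop :=
  ∀ a ∈ s, t.eval (e a) = f a ∧ t.cost (e a) ≤ q

theorem Computes.mono {t : DecisionTree n M} {s s' : Set ι} {q q' : ℕ} (h : t.Computes e f s q)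
    (hs : s' ⊆ s) (hq : q ≤ q') : t.Computes e f s' q' :=
  fun a ha => ⟨(h a (hs ha)).1, (h a (hs ha)).2.trans hq⟩

theorem computes_output {b : Bool} {s : Set ι} (h : ∀ a ∈ s, f a = b) :
    (output b : DecisionTree n M).Computes e f s 0 :=
  fun a ha => ⟨(h a ha).symm, le_rfl⟩

theorem computes_query {i : Fin n} {next : Fin M → DecisionTree n M} {s : Set ι} {q : ℕ}
    (h : ∀ v, (next v).Computes e f {a ∈ s | e a i = v} q) :
    (query i next).Computes e f s (q + 1) :=
  fun a ha => ⟨(h (e a i) a ⟨ha, rfl⟩).1, Nat.succ_le_succ (h (e a i) a ⟨ha, rfl⟩).2⟩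

theorem exists_computes_of_forall_eqOn (P : Finset (Fin n)) {s : Set ι} {q : ℕ}
    (h : ∀ b ∈ s, ∃ t : DecisionTree n M, t.Computes e f {a ∈ s | ∀ i ∈ P, e a i = e b i} q) :
    ∃ t : DecisionTree n M, t.Computes e f s (q + P.card) := by
  induction P using Finset.induction_on generalizing s with
  | empty =>
    obtain rfl | ⟨b, hb⟩ := s.eq_empty_or_nonempty
    · exact ⟨output true, fun a ha => ha.elim⟩
    · simpa using h b hb
  | insert i P hi ih =>
    have (v : Fin M) : ∃ t : DecisionTree n M, t.Computes e f {a ∈ s | e a i = v} (q + P.card) := by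
      refine ih fun b ⟨hb, hbv⟩ => ?_
      obtain ⟨t, ht⟩ := h b hb
      refine ⟨t, ht.mono (fun a ⟨⟨has, hav⟩, haP⟩ => ⟨has, ?_⟩) le_rfl⟩
      exact (Finset.forall_mem_insert _ _ _).mpr ⟨hav.trans hbv.symm, haP⟩
    choose next hnext using this
    rw [Finset.card_insert_of_notMem hi, ← add_assoc]
    exact ⟨query i next, computes_query hnext⟩

theorem exists_computes_of_injective (he : Function.Injective e) :
    ∃ t : DecisionTree n M, t.Computes e f Set.univ n := by
  have h := exists_computes_of_forall_eqOn (f := f) (s := Set.univ) (q := 0) Finset.univ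
    fun b _ => ⟨output (f b), computes_output fun a ha =>
      congrArg f (he (funext fun i => ha.2 i (Finset.mem_univ i)))⟩
  simpa using h

end DecisionTree

section CertificateState

theorem add_single_true_add_false (r : Bool → ℕ) (b : Bool) :
    (r + Pi.single b 1 : Bool → ℕ) true + (r + Pi.single b 1 : Bool → ℕ) false
      = r true + r false + 1 := by
  cases b <;> simp <;> omega

open Equiv (Perm)

variable {α : Type*} [DecidableEq α] {f : Perm α → Bool}

omit [DecidableEq α] in
theorem exists_perm_eq_on_union {x z : Perm α} {Q P : Finset α}
    (hposition : ∀ i ∈ Q, i ∈ P → x i = z i)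
    (hvalue : ∀ i ∈ Q, ∀ j ∈ P, x i = z j → i = j) :
    ∃ y : Perm α, (∀ i ∈ Q, y i = x i) ∧ ∀ i ∈ P, y i = z i := by
  classical
  obtain ⟨y, hy⟩ := Equiv.Perm.exists_extending_pair
    (Sum.elim Subtype.val Subtype.val : Q ⊕ ↥(P \ Q) → α)
    (Sum.elim (fun i => x i) fun j => z j)
    (Subtype.val_injective.sumElim Subtype.val_injective fun i j h =>
      (Finset.mem_sdiff.mp j.2).2 (h ▸ i.2))
    ((x.injective.comp Subtype.val_injective).sumElim (z.injective.comp Subtype.val_injective)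
      fun i j h => (Finset.mem_sdiff.mp j.2).2 <|
        hvalue i i.2 j (Finset.mem_sdiff.mp j.2).1 h ▸ i.2)
  have hyQ (i : α) (hi : i ∈ Q) : y i = x i := hy (.inl ⟨i, hi⟩)
  refine ⟨y, hyQ, fun i hi => ?_⟩
  by_cases hiQ : i ∈ Q
  · exact (hyQ i hiQ).trans (hposition i hiQ hi)
  · exact hy (.inr ⟨i, Finset.mem_sdiff.mpr ⟨hi, hiQ⟩⟩)

omit [DecidableEq α] in
theorem IsCertificate.exists_conflict {x z : Perm α} {Q P : Finset α}
    (hQ : IsCertificate (fun π : Perm α => ⇑π) f x Q)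
    (hP : IsCertificate (fun π : Perm α => ⇑π) f z P) (hne : f x ≠ f z) :
    (∃ i ∈ Q, i ∈ P ∧ x i ≠ z i) ∨ ∃ i ∈ Q, ∃ j ∈ P, x i = z j ∧ i ≠ j := by
  by_contra! hcon
  obtain ⟨y, hyQ, hyP⟩ := exists_perm_eq_on_union hcon.1 hcon.2
  exact hne ((hQ y hyQ).symm.trans (hP y hyP))

theorem IsCertificate.card_inter_add_card_inter_lt [Fintype α] {a x z : Perm α}
    {S V Q P : Finset α} (hx : x ∈ agreeing a S) (hz : z ∈ agreeing a S)
    (hQ : IsCertificate (fun π : Perm α => ⇑π) f x Q)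
    (hP : IsCertificate (fun π : Perm α => ⇑π) f z P) (hne : f x ≠ f z)
    (hPV : ∀ i ∈ P, z i ∈ V → i ∈ S) :
    (Q ∩ S).card + (Q.image x ∩ V).card
      < (Q ∩ (S ∪ P)).card + (Q.image x ∩ (V ∪ P.image z)).card := by
  rw [mem_agreeing] at hx hz
  have hS : Q ∩ S ⊆ Q ∩ (S ∪ P) := Finset.inter_subset_inter_left Finset.subset_union_left
  have hV : Q.image x ∩ V ⊆ Q.image x ∩ (V ∪ P.image z) :=
    Finset.inter_subset_inter_left Finset.subset_union_left
  obtain ⟨i, hiQ, hiP, hxz⟩ | ⟨i, hiQ, j, hjP, hxz, hij⟩ := hQ.exists_conflict hP hne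
  · have hiS : i ∉ S := fun hiS => hxz ((hx i hiS).trans (hz i hiS).symm)
    refine add_lt_add_of_lt_of_le (Finset.card_lt_card ?_) (Finset.card_le_card hV)
    exact (Finset.ssubset_iff_of_subset hS).mpr ⟨i, by simp [hiQ, hiP], by simp [hiS]⟩
  · have hxV : x i ∉ V := fun hxV => by
      have hjS := hPV j hjP (hxz ▸ hxV)
      exact hij (x.injective (hxz.trans ((hz j hjS).trans (hx j hjS).symm)))
    refine add_lt_add_of_le_of_lt (Finset.card_le_card hS) (Finset.card_lt_card ?_)
    refine (Finset.ssubset_iff_of_subset hV).mpr ⟨x i, ?_, by simp [hxV]⟩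
    exact Finset.mem_inter.mpr ⟨Finset.mem_image_of_mem x hiQ,
      Finset.mem_union_right _ (hxz ▸ Finset.mem_image_of_mem z hjP)⟩

variable [Fintype α]

/-- The state of the certificate algorithm after it has queried `r b` certificates for the value
`b`, each of size at most `C`. The unknown permutation agrees with `a` on the set `S` of queried
positions, and `V` contains the values that these certificates take. By `le_card`, each certificate
of a permutation `x` that is still possible has met every queried certificate for the other value
in a new position or a new value. -/
structure CertificateState (f : Perm α → Bool) (C : ℕ) (a : Perm α) (S V : Finset α)
    (r : Bool → ℕ) : Prop where
  card_positions_le : S.card ≤ (r true + r false) * C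
  card_values_le : V.card ≤ (r true + r false) * C
  le_card : ∀ x ∈ agreeing a S, ∀ Q : Finset α, Q.card ≤ C →
    IsCertificate (fun π : Perm α => ⇑π) f x Q →
    r (!f x) ≤ (Q ∩ S).card + (Q.image x ∩ V).card

namespace CertificateState

variable {C : ℕ} {a : Perm α} {S V : Finset α} {r : Bool → ℕ}

theorem init (f : Perm α → Bool) (C : ℕ) (a : Perm α) : CertificateState f C a ∅ ∅ 0 :=
  ⟨by simp, by simp, by simp⟩

theorem insert_certificate (h : CertificateState f C a S V r) {b z : Perm α} {P : Finset α}
    (hb : b ∈ agreeing a S) (hz : z ∈ agreeing a S)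
    (hP : IsCertificate (fun π : Perm α => ⇑π) f z P) (hPcard : P.card ≤ C)
    (hPV : ∀ i ∈ P, z i ∈ V → i ∈ S) :
    CertificateState f C b (S ∪ P) (V ∪ P.image z) (r + Pi.single (f z) 1) := by
  refine ⟨?_, ?_, fun x hx Q hQcard hQ => ?_⟩
  · rw [add_single_true_add_false, Nat.add_one_mul]
    exact (Finset.card_union_le _ _).trans (add_le_add h.card_positions_le hPcard)
  · rw [add_single_true_add_false, Nat.add_one_mul]
    exact (Finset.card_union_le _ _).trans
      (add_le_add h.card_values_le (Finset.card_image_le.trans hPcard))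
  · have hxa : x ∈ agreeing a S := mem_agreeing.mpr fun i hi =>
      (mem_agreeing.mp hx i (Finset.mem_union_left P hi)).trans (mem_agreeing.mp hb i hi)
    have hle := h.le_card x hxa Q hQcard hQ
    by_cases hxz : f x = f z
    · rw [Pi.add_apply, hxz, Pi.single_eq_of_ne (by simp), add_zero, ← hxz]
      refine hle.trans ?_
      gcongr <;> exact Finset.subset_union_left
    · have hnot : (!f x) = f z := Bool.not_eq.mpr hxz
      rw [Pi.add_apply, hnot, Pi.single_eq_same, ← hnot]
      exact hle.trans_lt (hQ.card_inter_add_card_inter_lt hxa hz hP hxz hPV)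

theorem le_two_mul (h : CertificateState f C a S V r) {x : Perm α} (hx : x ∈ agreeing a S)
    {Q : Finset α} (hQcard : Q.card ≤ C) (hQ : IsCertificate (fun π : Perm α => ⇑π) f x Q) :
    r (!f x) ≤ 2 * C :=
  calc r (!f x) ≤ (Q ∩ S).card + (Q.image x ∩ V).card := h.le_card x hx Q hQcard hQ
    _ ≤ Q.card + Q.card := add_le_add (Finset.card_le_card Finset.inter_subset_left)
        ((Finset.card_le_card Finset.inter_subset_left).trans Finset.card_image_le)
    _ ≤ 2 * C := by omega

theorem eq_decide (h : CertificateState f C a S V r) (hr : r true + r false = 4 * C + 1)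
    {x : Perm α} (hx : x ∈ agreeing a S) {Q : Finset α} (hQcard : Q.card ≤ C)
    (hQ : IsCertificate (fun π : Perm α => ⇑π) f x Q) : f x = decide (2 * C < r true) := by
  have hle := h.le_two_mul hx hQcard hQ
  cases hfx : f x <;> rw [hfx] at hle <;> simp only [Bool.not_true, Bool.not_false] at hle
  · simpa using hle
  · simp only [true_eq_decide_iff]
    omega

end CertificateState
end CertificateState

namespace QueryWeights

open Equiv (Perm)

variable {n W : ℕ} {f : Perm (Fin n) → Bool} (H : QueryWeights (fun π : Perm (Fin n) => ⇑π) f W)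

include H

theorem exists_computes_of_certificateState {C : ℕ} (hC : C = 3 * W * (2 * W))
    (hn : (4 * C + 1) * C * (2 + (6 * W + 1) * (3 * W)) ≤ n) (R : ℕ) {a : Perm (Fin n)}
    {S V : Finset (Fin n)} {r : Bool → ℕ} (hr : r true + r false + R = 4 * C + 1)
    (hstate : CertificateState f C a S V r) :
    ∃ t : DecisionTree n n, t.Computes (fun π : Perm (Fin n) => ⇑π) f (agreeing a S) (R * C) := by
  induction R generalizing a S V r with
  | zero =>
    refine ⟨_, (DecisionTree.computes_output (b := decide (2 * C < r true)) fun x hx => ?_).mono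
      subset_rfl (Nat.zero_le _)⟩
    obtain ⟨Q, hQcard, hQ⟩ := H.exists_isCertificate x
    exact hstate.eq_decide hr hx (hQcard.trans (by rw [hC]; gcongr; omega)) hQ
  | succ R ih =>
    have hsize : (r true + r false) * C ≤ (4 * C + 1) * C :=
      Nat.mul_le_mul_right C (by omega)
    obtain ⟨z, hz, P, hPcard, hP, hPV⟩ := H.exists_agreeing_isCertificate a S V <| by
      rw [Fintype.card_fin]
      calc S.card + V.card * (1 + (6 * W + 1) * (3 * W))
          ≤ (4 * C + 1) * C + (4 * C + 1) * C * (1 + (6 * W + 1) * (3 * W)) := by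
            gcongr
            · exact hstate.card_positions_le.trans hsize
            · exact hstate.card_values_le.trans hsize
        _ = (4 * C + 1) * C * (2 + (6 * W + 1) * (3 * W)) := by ring
        _ ≤ n := hn
    rw [← hC] at hPcard
    obtain ⟨t, ht⟩ := DecisionTree.exists_computes_of_forall_eqOn P
        (s := (agreeing a S : Set (Perm (Fin n)))) fun b hb => by
      obtain ⟨t, ht⟩ := ih (r := r + Pi.single (f z) 1)
        (by rw [add_single_true_add_false]; omega) (hstate.insert_certificate hb hz hP hPcard hPV)
      refine ⟨t, ht.mono (fun x hx => ?_) le_rfl⟩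
      simp only [Finset.mem_coe, mem_agreeing, Set.mem_ofPred_eq] at hx hb ⊢
      exact Finset.forall_mem_union.mpr ⟨fun i hi => (hx.1 i hi).trans (hb i hi).symm, hx.2⟩
    exact ⟨t, ht.mono subset_rfl (by rw [Nat.add_one_mul]; gcongr)⟩

theorem exists_computes_perm :
    ∃ t : DecisionTree n n, t.Computes (fun π : Perm (Fin n) => ⇑π) f Set.univ (3450 * W ^ 6) := by
  by_cases hconst : ∀ x, f x = f 1
  · exact ⟨_, (DecisionTree.computes_output fun x _ => hconst x).mono subset_rfl (Nat.zero_le _)⟩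
  push Not at hconst
  obtain ⟨x, hx⟩ := hconst
  have hW : 1 ≤ W := H.pos_of_ne hx
  obtain ⟨C, hC⟩ : ∃ C, C = 3 * W * (2 * W) := ⟨_, rfl⟩
  have hCC : (4 * C + 1) * C ≤ 150 * W ^ 4 :=
    calc (4 * C + 1) * C ≤ (25 * W ^ 2) * (6 * W ^ 2) :=
          Nat.mul_le_mul (by rw [hC]; nlinarith) (by rw [hC]; nlinarith)
      _ = 150 * W ^ 4 := by ring
  by_cases hn : (4 * C + 1) * C * (2 + (6 * W + 1) * (3 * W)) ≤ n
  · obtain ⟨t, ht⟩ := H.exists_computes_of_certificateState hC hn (4 * C + 1) (by simp)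
      (CertificateState.init f C 1)
    refine ⟨t, ht.mono (by simp [Set.subset_def]) (hCC.trans ?_)⟩
    gcongr <;> omega
  · obtain ⟨t, ht⟩ := DecisionTree.exists_computes_of_injective (f := f)
      (DFunLike.coe_injective : Function.Injective fun π : Perm (Fin n) => ⇑π)
    refine ⟨t, ht.mono subset_rfl ?_⟩
    calc n ≤ (4 * C + 1) * C * (2 + (6 * W + 1) * (3 * W)) := (not_le.mp hn).le
      _ ≤ (150 * W ^ 4) * (23 * W ^ 2) := by gcongr; nlinarith
      _ = 3450 * W ^ 6 := by ring

end QueryWeights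

/-! ### From permutations to types -/

section InputType

open Equiv (Perm)

variable {n M : ℕ} {x y : Input n M}

theorem inputType_comp_perm (x : Input n M) (π : Perm (Fin n)) :
    inputType (x ∘ π) = inputType x := by
  simp only [inputType, ← Multiset.map_map]
  congr 1
  exact congrArg Finset.val (Finset.map_univ_equiv π)

theorem exists_perm_of_inputType_eq (h : inputType x = inputType y) :
    ∃ π : Perm (Fin n), x = y ∘ π := by
  have hfiber (v : Fin M) : Nonempty ({i // x i = v} ≃ {i // y i = v}) := by
    have hv := congrArg (Multiset.count v) h
    simp only [inputType, Multiset.count_map] at hv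
    refine ⟨Fintype.equivOfCardEq ?_⟩
    simpa [Fintype.card_subtype, Finset.card, Finset.filter, eq_comm] using hv
  exact ⟨Equiv.ofFiberEquiv fun v => (hfiber v).some,
    funext fun i => (Equiv.ofFiberEquiv_map _ i).symm⟩

theorem exists_perm_of_inputType_eq_of_eqOn (h : inputType x = inputType y) {a : Perm (Fin n)}
    {S : Finset (Fin n)} (hS : ∀ i ∈ S, x i = y (a i)) :
    ∃ π ∈ agreeing a S, x = y ∘ π := by
  induction S using Finset.induction_on with
  | empty => simpa using exists_perm_of_inputType_eq h
  | insert i S hi ih =>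
    obtain ⟨hxi, hxS⟩ := (Finset.forall_mem_insert _ _ _).mp hS
    obtain ⟨π, hπS, rfl⟩ := ih hxS
    rw [mem_agreeing] at hπS
    refine ⟨π.trans (Equiv.swap (π i) (a i)), ?_, ?_⟩
    · refine mem_agreeing.mpr ((Finset.forall_mem_insert _ _ _).mpr ⟨by simp, fun j hj => ?_⟩)
      have hji : j ≠ i := ne_of_mem_of_not_mem hj hi
      rw [Equiv.trans_apply, Equiv.swap_apply_of_ne_of_ne (π.injective.ne hji), hπS j hj]
      rw [hπS j hj]
      exact a.injective.ne hji
    · exact funext fun j => (Equiv.apply_swap_eq_self hxi (π j)).symm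

theorem DecisionTree.exists_simulation (x₀ : Input n M) (t : DecisionTree n n)
    (S : Finset (Fin n)) (a : Perm (Fin n)) :
    ∃ t' : DecisionTree n M, ∀ x : Input n M, inputType x = inputType x₀ →
      (∀ i ∈ S, x i = x₀ (a i)) →
      ∃ π ∈ agreeing a S, x = x₀ ∘ π ∧ t'.eval x = t.eval π ∧ t'.cost x = t.cost π := by
  induction t generalizing S a with
  | output b =>
    refine ⟨.output b, fun x hx hxS => ?_⟩
    obtain ⟨π, hπS, hxπ⟩ := exists_perm_of_inputType_eq_of_eqOn hx hxS
    exact ⟨π, hπS, hxπ, rfl, rfl⟩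
  | query i next ih =>
    have hnext (v : Fin M) : ∃ t' : DecisionTree n M, ∀ x : Input n M, inputType x = inputType x₀ →
        (∀ j ∈ S, x j = x₀ (a j)) → x i = v →
        ∃ π ∈ agreeing a S, x = x₀ ∘ π ∧
          t'.eval x = (next (π i)).eval π ∧ t'.cost x = (next (π i)).cost π := by
      by_cases hv : ∃ b ∈ agreeing a S, x₀ (b i) = v
      · obtain ⟨b, hbS, hbi⟩ := hv
        rw [mem_agreeing] at hbS
        obtain ⟨t', ht'⟩ := ih (b i) (insert i S) b
        refine ⟨t', fun x hx hxS hxi => ?_⟩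
        obtain ⟨π, hπ, hxπ, heval, hcost⟩ := ht' x hx <| (Finset.forall_mem_insert _ _ _).mpr
          ⟨hxi.trans hbi.symm, fun j hj => by rw [hxS j hj, hbS j hj]⟩
        obtain ⟨hπi, hπS⟩ := (Finset.forall_mem_insert _ _ _).mp (mem_agreeing.mp hπ)
        exact ⟨π, mem_agreeing.mpr fun j hj => (hπS j hj).trans (hbS j hj), hxπ,
          by rw [heval, hπi], by rw [hcost, hπi]⟩
      · refine ⟨.output true, fun x hx hxS hxi => ?_⟩
        obtain ⟨π, hπS, rfl⟩ := exists_perm_of_inputType_eq_of_eqOn hx hxS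
        exact absurd ⟨π, hπS, hxi⟩ hv
    choose t' ht' using hnext
    refine ⟨.query i t', fun x hx hxS => ?_⟩
    obtain ⟨π, hπS, hxπ, heval, hcost⟩ := ht' (x i) x hx hxS rfl
    exact ⟨π, hπS, hxπ, heval, congrArg (· + 1) hcost⟩

end InputType

theorem QueryWeights.detComputable {n M W : ℕ} {T : Set (Input n M)} (hT : IsTypePromise T)
    {f : T → Bool} (H : QueryWeights (Subtype.val : T → Input n M) f W) :
    DetComputable f (3450 * W ^ 6) := by
  obtain ⟨x₀, rfl⟩ := hT
  obtain ⟨t, ht⟩ := (H.comap x₀ (fun π : Equiv.Perm (Fin n) => ⇑π)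
    (fun π => ⟨x₀ ∘ π, inputType_comp_perm x₀ π⟩) fun _ => rfl).exists_computes_perm
  obtain ⟨t', ht'⟩ := t.exists_simulation x₀ ∅ 1
  refine ⟨t', fun ⟨x, hx⟩ => ?_⟩
  obtain ⟨π, -, rfl, heval, hcost⟩ := ht' x hx (by simp)
  rw [heval, hcost]
  exact ht π (Set.mem_univ π)

/-! ### Randomized algorithms as query weights -/

theorem le_abs_sub_of_abs_sub_boole_le {p p' : ℝ} {b b' : Bool} (hb : b ≠ b')
    (h : |p - if b then 1 else 0| ≤ 1 / 3) (h' : |p' - if b' then 1 else 0| ≤ 1 / 3) :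
    1 / 3 ≤ |p - p'| := by
  rw [abs_le] at h h'
  rw [le_abs]
  cases b <;> cases b' <;> simp only [reduceIte, Bool.false_eq_true] at h h'
  · exact absurd rfl hb
  · right; linarith
  · left; linarith
  · exact absurd rfl hb

namespace DecisionTree

variable {n M : ℕ}

/-- The algorithm `t` with a budget of `q` queries: it outputs `false` instead of exceeding it. -/
def truncate : ℕ → DecisionTree n M → DecisionTree n M
  | _, output b => output b
  | 0, query _ _ => output false
  | q + 1, query i next => query i fun v => (next v).truncate q

theorem cost_truncate_le (q : ℕ) (t : DecisionTree n M) (x : Input n M) :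
    (t.truncate q).cost x ≤ q := by
  induction q generalizing t with
  | zero => cases t <;> simp only [truncate, cost, le_refl]
  | succ q ih =>
    cases t with
    | output b => simp only [truncate, cost, zero_le]
    | query i next => exact Nat.succ_le_succ (ih _)

theorem eval_truncate {q : ℕ} {t : DecisionTree n M} {x : Input n M} (h : t.cost x ≤ q) :
    (t.truncate q).eval x = t.eval x := by
  induction q generalizing t with
  | zero => cases t with
    | output b => rfl
    | query i next => exact absurd h (Nat.not_succ_le_zero _)
  | succ q ih => cases t with
    | output b => rfl
    | query i next => exact ih (Nat.le_of_succ_le_succ h)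

/-- The set of positions that `t` queries on input `x`. -/
def queried : DecisionTree n M → Input n M → Finset (Fin n)
  | output _, _ => ∅
  | query i next, x => insert i ((next (x i)).queried x)

theorem card_queried_le_cost (t : DecisionTree n M) (x : Input n M) :
    (t.queried x).card ≤ t.cost x := by
  induction t with
  | output b => exact le_rfl
  | query i next ih => exact (Finset.card_insert_le _ _).trans (Nat.succ_le_succ (ih _))

theorem eval_congr {t : DecisionTree n M} {x y : Input n M} (h : ∀ i ∈ t.queried x, x i = y i) :
    t.eval x = t.eval y := by
  induction t with
  | output b => rfl
  | query i next ih =>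
    obtain ⟨hi, hnext⟩ := (Finset.forall_mem_insert _ _ _).mp h
    rw [eval, eval, ← hi]
    exact ih _ hnext

instance : MeasurableSpace (DecisionTree n M) := ⊤

instance : DiscreteMeasurableSpace (DecisionTree n M) := ⟨fun _ => trivial⟩

open MeasureTheory

/-- The probability that a random decision tree with distribution `ν` outputs `true` on `x`. -/
noncomputable def acceptProb (ν : Measure (DecisionTree n M)) (x : Input n M) : ℝ :=
  ν.real {t | t.eval x = true}

/-- The probability that a random decision tree with distribution `ν` queries position `i`
of `x`. -/
noncomputable def queryProb (ν : Measure (DecisionTree n M)) (x : Input n M) (i : Fin n) : ℝ :=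
  ν.real {t | i ∈ t.queried x}

variable {ν : Measure (DecisionTree n M)} [IsProbabilityMeasure ν]

theorem abs_acceptProb_sub_boole (x : Input n M) (b : Bool) :
    |acceptProb ν x - if b then 1 else 0| = ν.real {t | t.eval x ≠ b} := by
  cases b
  · simp [acceptProb]
  · have hcompl : {t : DecisionTree n M | t.eval x ≠ true} = {t | t.eval x = true}ᶜ := rfl
    rw [hcompl, probReal_compl_eq_one_sub .of_discrete, if_pos rfl, abs_sub_comm]
    exact abs_of_nonneg (sub_nonneg.mpr measureReal_le_one)

theorem abs_acceptProb_sub_le (x y : Input n M) :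
    |acceptProb ν x - acceptProb ν y| ≤ ∑ i ∈ diffSet x y, queryProb ν x i := by
  have hsub : symmDiff {t : DecisionTree n M | t.eval x = true} {t | t.eval y = true} ⊆
      ⋃ i ∈ diffSet x y, {t | i ∈ t.queried x} := by
    intro t ht
    by_contra hunqueried
    have heval : t.eval x = t.eval y := eval_congr fun i hi => by
      by_contra hne
      exact hunqueried (Set.mem_biUnion (mem_diffSet.mpr hne) hi)
    simp [Set.mem_symmDiff, heval] at ht
  calc |acceptProb ν x - acceptProb ν y|
      ≤ ν.real (symmDiff {t | t.eval x = true} {t | t.eval y = true}) :=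
        abs_measureReal_sub_le_measureReal_symmDiff
          MeasurableSet.of_discrete.nullMeasurableSet
          MeasurableSet.of_discrete.nullMeasurableSet
    _ ≤ ν.real (⋃ i ∈ diffSet x y, {t | i ∈ t.queried x}) :=
        measureReal_mono hsub (measure_ne_top ν _)
    _ ≤ ∑ i ∈ diffSet x y, queryProb ν x i := measureReal_biUnion_finset_le _ _

theorem sum_queryProb_le {q : ℕ} {x : Input n M} (hq : ∀ᵐ t ∂ν, t.cost x ≤ q) :
    ∑ i, queryProb ν x i ≤ q := by
  let query (i : Fin n) : Set (DecisionTree n M) := {t | i ∈ t.queried x}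
  have hquery (i : Fin n) : Integrable ((query i).indicator (1 : DecisionTree n M → ℝ)) ν :=
    (integrable_const 1).indicator .of_discrete
  have hcard (t : DecisionTree n M) :
      ∑ i, (query i).indicator (1 : DecisionTree n M → ℝ) t = (t.queried x).card := by
    simp [query, Set.indicator_apply]
  calc ∑ i, queryProb ν x i
      = ∫ t, ∑ i, (query i).indicator (1 : DecisionTree n M → ℝ) t ∂ν := by
        rw [integral_finsetSum _ fun i _ => hquery i]
        exact Finset.sum_congr rfl fun i _ => (integral_indicator_one .of_discrete).symm
    _ ≤ ∫ _, (q : ℝ) ∂ν := by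
        refine integral_mono_ae (integrable_finsetSum _ fun i _ => hquery i) (integrable_const _) ?_
        filter_upwards [hq] with t ht
        rw [hcard]
        exact_mod_cast (t.card_queried_le_cost x).trans ht
    _ = q := by simp

end DecisionTree

open DecisionTree MeasureTheory in
theorem RandComputable.nonempty_queryWeights {n M : ℕ} {X : Set (Input n M)} {f : X → Bool} {q : ℕ}
    (h : RandComputable f q) :
    Nonempty (QueryWeights (Subtype.val : X → Input n M) f (12 * q)) := by
  obtain ⟨μ, hμ⟩ := h
  have htruncate : Measurable (truncate q : DecisionTree n M → _) := .of_discrete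
  let ν := μ.toMeasure.map (truncate q)
  have : IsProbabilityMeasure ν := Measure.isProbabilityMeasure_map htruncate.aemeasurable
  have hcost (x : Input n M) : ∀ᵐ t ∂ν, t.cost x ≤ q :=
    (ae_map_iff htruncate.aemeasurable .of_discrete).mpr
      (Filter.Eventually.of_forall fun t => t.cost_truncate_le q x)
  have herror (x : X) : |acceptProb ν x - if f x then 1 else 0| ≤ 1 / 3 := by
    rw [abs_acceptProb_sub_boole, map_measureReal_apply htruncate .of_discrete]
    have hle : μ.toMeasure (truncate q ⁻¹' {t | t.eval x ≠ f x}) ≤ 1 / 3 := by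
      refine le_trans (PMF.toMeasure_mono _ .of_discrete ?_)
        ((μ.toMeasure_apply_eq_toOuterMeasure_apply .of_discrete).trans_le (hμ x).1)
      rintro t ⟨ht, hsupport⟩
      rwa [Set.mem_preimage, Set.mem_ofPred_eq, eval_truncate ((hμ x).2 t hsupport)] at ht
    simpa [measureReal_def] using ENNReal.toReal_mono (by simp) hle
  exact ⟨{
    p := acceptProb ν
    w := fun x i => 12 * queryProb ν x i
    nonneg := fun x i => mul_nonneg (by norm_num) measureReal_nonneg
    sum_le := fun x => by
      rw [← Finset.mul_sum]
      push_cast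
      linarith [sum_queryProb_le (hcost x)]
    stable := fun x y hxy => by
      rw [← Finset.mul_sum] at hxy
      linarith [abs_acceptProb_sub_le (ν := ν) x y]
    separated := fun x y hxy => le_abs_sub_of_abs_sub_boole_le hxy (herror x) (herror y) }⟩

/-! ### Quantum algorithms as query weights -/

section AmplitudeNorm

variable {ι : Type*} [Fintype ι]

/-- The Euclidean norm of a vector of amplitudes. States are plain functions, whose own norm
is the supremum norm. -/
noncomputable def ampNorm (ψ : ι → ℂ) : ℝ := ‖WithLp.toLp 2 ψ‖

theorem ampNorm_nonneg (ψ : ι → ℂ) : 0 ≤ ampNorm ψ := norm_nonneg _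

theorem ampNorm_sq (ψ : ι → ℂ) : ampNorm ψ ^ 2 = ∑ s, ‖ψ s‖ ^ 2 :=
  EuclideanSpace.norm_sq_eq _

theorem ampNorm_sub_le (ψ φ χ : ι → ℂ) :
    ampNorm (ψ - χ) ≤ ampNorm (ψ - φ) + ampNorm (φ - χ) :=
  norm_sub_le_norm_sub_add_norm_sub (WithLp.toLp 2 ψ) (WithLp.toLp 2 φ) (WithLp.toLp 2 χ)

theorem ampNorm_mulVec_unitary [DecidableEq ι] (U : Matrix.unitaryGroup ι ℂ) (ψ : ι → ℂ) :
    ampNorm ((U : Matrix ι ι ℂ).mulVec ψ) = ampNorm ψ :=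
  ContinuousLinearMap.norm_map_of_mem_unitary
    (Unitary.map_mem (Matrix.toEuclideanCLM (n := ι) (𝕜 := ℂ)) U.2) (WithLp.toLp 2 ψ)

theorem sum_norm_mul_norm_le (ψ φ : ι → ℂ) : ∑ s, ‖ψ s‖ * ‖φ s‖ ≤ ampNorm ψ * ampNorm φ := by
  simpa only [ampNorm, EuclideanSpace.norm_eq] using
    Real.sum_mul_le_sqrt_mul_sqrt Finset.univ (fun s => ‖ψ s‖) fun s => ‖φ s‖

theorem abs_sum_sq_sub_sum_sq_le (ψ φ : ι → ℂ) (s : Finset ι) :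
    |∑ i ∈ s, ‖ψ i‖ ^ 2 - ∑ i ∈ s, ‖φ i‖ ^ 2| ≤ (ampNorm ψ + ampNorm φ) * ampNorm (ψ - φ) := by
  have hterm (i : ι) : |‖ψ i‖ ^ 2 - ‖φ i‖ ^ 2| ≤ (‖ψ i‖ + ‖φ i‖) * ‖(ψ - φ) i‖ := by
    rw [sq_sub_sq, abs_mul, abs_of_nonneg (by positivity : 0 ≤ ‖ψ i‖ + ‖φ i‖)]
    gcongr
    exact abs_norm_sub_norm_le _ _
  calc |∑ i ∈ s, ‖ψ i‖ ^ 2 - ∑ i ∈ s, ‖φ i‖ ^ 2|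
      ≤ ∑ i ∈ s, |‖ψ i‖ ^ 2 - ‖φ i‖ ^ 2| := by
        rw [← Finset.sum_sub_distrib]
        exact Finset.abs_sum_le_sum_abs _ _
    _ ≤ ∑ i, |‖ψ i‖ ^ 2 - ‖φ i‖ ^ 2| := Finset.sum_le_univ_sum_of_nonneg fun _ => abs_nonneg _
    _ ≤ ∑ i, (‖ψ i‖ + ‖φ i‖) * ‖(ψ - φ) i‖ := Finset.sum_le_sum fun i _ => hterm i
    _ ≤ (ampNorm ψ + ampNorm φ) * ampNorm (ψ - φ) := by
        simp only [add_mul, Finset.sum_add_distrib]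
        exact add_le_add (sum_norm_mul_norm_le _ _) (sum_norm_mul_norm_le _ _)

end AmplitudeNorm

section Oracle

variable {n M d : ℕ}

theorem sum_comp_sub_right (c : Fin M) (g : Fin M → ℝ) : ∑ b, g (b - c) = ∑ b, g b := by
  have : NeZero M := ⟨c.pos.ne'⟩
  exact (Equiv.subRight c).sum_comp g

/-- The probability that measuring the query register of `ψ` gives the position `i`. -/
noncomputable def queryMass (ψ : QBasis n M d → ℂ) (i : Fin n) : ℝ :=
  ∑ b : Fin M, ∑ w : Fin d, ‖ψ (some i, b, w)‖ ^ 2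

theorem queryMass_nonneg (ψ : QBasis n M d → ℂ) (i : Fin n) : 0 ≤ queryMass ψ i :=
  Finset.sum_nonneg fun _ _ => Finset.sum_nonneg fun _ _ => sq_nonneg _

theorem ampNorm_sq_eq_add_sum_queryMass (ψ : QBasis n M d → ℂ) : ampNorm ψ ^ 2 =
    (∑ b : Fin M, ∑ w : Fin d, ‖ψ (none, b, w)‖ ^ 2) + ∑ i, queryMass ψ i := by
  simp only [ampNorm_sq, Fintype.sum_prod_type, Fintype.sum_option, queryMass]

theorem sum_queryMass_le (ψ : QBasis n M d → ℂ) : ∑ i, queryMass ψ i ≤ ampNorm ψ ^ 2 := by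
  rw [ampNorm_sq_eq_add_sum_queryMass]
  exact le_add_of_nonneg_left
    (Finset.sum_nonneg fun _ _ => Finset.sum_nonneg fun _ _ => sq_nonneg _)

theorem queryMass_sub_le (ψ φ : QBasis n M d → ℂ) (i : Fin n) :
    queryMass (ψ - φ) i ≤ 2 * (queryMass ψ i + queryMass φ i) := by
  simp only [queryMass, Finset.mul_sum, ← Finset.sum_add_distrib]
  refine Finset.sum_le_sum fun b _ => Finset.sum_le_sum fun w _ => ?_
  exact (pow_le_pow_left₀ (norm_nonneg _) (norm_sub_le _ _) 2).trans add_sq_le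

theorem queryMass_oracle (x : Input n M) (ψ : QBasis n M d → ℂ) (i : Fin n) :
    queryMass (oracle x ψ) i = queryMass ψ i :=
  sum_comp_sub_right (x i) fun b => ∑ w, ‖ψ (some i, b, w)‖ ^ 2

theorem ampNorm_oracle (x : Input n M) (ψ : QBasis n M d → ℂ) :
    ampNorm (oracle x ψ) = ampNorm ψ := by
  rw [← sq_eq_sq₀ (ampNorm_nonneg _) (ampNorm_nonneg _)]
  simp only [ampNorm_sq_eq_add_sum_queryMass, queryMass_oracle]
  rfl

theorem oracle_sub (x : Input n M) (ψ φ : QBasis n M d → ℂ) :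
    oracle x (ψ - φ) = oracle x ψ - oracle x φ := by
  funext ⟨o, b, w⟩
  cases o <;> rfl

theorem queryMass_oracle_sub_oracle_of_eq {x y : Input n M} {i : Fin n} (h : x i = y i)
    (ψ : QBasis n M d → ℂ) : queryMass (oracle x ψ - oracle y ψ) i = 0 := by
  simp [queryMass, oracle, h]

theorem ampNorm_oracle_sub_oracle_le (x y : Input n M) (ψ : QBasis n M d → ℂ) :
    ampNorm (oracle x ψ - oracle y ψ) ≤ 2 * √(∑ i ∈ diffSet x y, queryMass ψ i) := by
  have hnull : ∑ b : Fin M, ∑ w : Fin d, ‖(oracle x ψ - oracle y ψ) (none, b, w)‖ ^ 2 = 0 := by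
    simp [oracle]
  have hmass (i : Fin n) : queryMass (oracle x ψ - oracle y ψ) i ≤ 4 * queryMass ψ i := by
    have := queryMass_sub_le (oracle x ψ) (oracle y ψ) i
    rw [queryMass_oracle, queryMass_oracle] at this
    linarith
  have hsq : ampNorm (oracle x ψ - oracle y ψ) ^ 2 ≤ 4 * ∑ i ∈ diffSet x y, queryMass ψ i := by
    calc ampNorm (oracle x ψ - oracle y ψ) ^ 2
        = ∑ i, queryMass (oracle x ψ - oracle y ψ) i := by
          rw [ampNorm_sq_eq_add_sum_queryMass, hnull, zero_add]
      _ = ∑ i ∈ diffSet x y, queryMass (oracle x ψ - oracle y ψ) i :=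
          (Finset.sum_subset (Finset.subset_univ _) fun i _ hi =>
            queryMass_oracle_sub_oracle_of_eq (not_not.mp (mem_diffSet.not.mp hi)) ψ).symm
      _ ≤ 4 * ∑ i ∈ diffSet x y, queryMass ψ i := by
          rw [Finset.mul_sum]
          exact Finset.sum_le_sum fun i _ => hmass i
  refine (Real.le_sqrt_of_sq_le hsq).trans_eq ?_
  rw [Real.sqrt_mul (by norm_num), show (4 : ℝ) = 2 ^ 2 by norm_num, Real.sqrt_sq (by norm_num)]

end Oracle

namespace QuantumAlgorithm

variable {n M : ℕ} (A : QuantumAlgorithm n M)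

theorem ampNorm_stateAfter (x : Input n M) (k : ℕ) (hk : k < A.queries + 1) :
    ampNorm (A.stateAfter x k hk) = 1 := by
  induction k with
  | zero =>
    rw [stateAfter, ampNorm_mulVec_unitary, ampNorm]
    exact (PiLp.norm_single 2 (fun _ => ℂ) A.start 1).trans norm_one
  | succ k ih => rw [stateAfter, ampNorm_mulVec_unitary, ampNorm_oracle, ih]

theorem outputProb_eq_sum_filter (x : Input n M) (b : Bool) :
    A.outputProb x b =
      ∑ s with A.out s = b, ‖A.stateAfter x A.queries (Nat.lt_succ_self _) s‖ ^ 2 :=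
  (Finset.sum_filter _ _).symm

theorem outputProb_nonneg (x : Input n M) (b : Bool) : 0 ≤ A.outputProb x b := by
  rw [outputProb_eq_sum_filter]
  exact Finset.sum_nonneg fun _ _ => sq_nonneg _

theorem outputProb_true_add_false (x : Input n M) :
    A.outputProb x true + A.outputProb x false = 1 := by
  simp only [outputProb_eq_sum_filter, ← Bool.not_eq_true]
  rw [Finset.sum_filter_add_sum_filter_not, ← ampNorm_sq, ampNorm_stateAfter, one_pow]

theorem abs_outputProb_sub_boole (x : Input n M) (b : Bool) :
    |A.outputProb x true - if b then 1 else 0| = A.outputProb x (!b) := by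
  cases b
  · simp [abs_of_nonneg (A.outputProb_nonneg x true)]
  · rw [← A.outputProb_true_add_false x, if_pos rfl, sub_add_cancel_left, abs_neg]
    exact abs_of_nonneg (A.outputProb_nonneg x false)

/-- The expected number of times that position `i` is found when, on input `x`, the query
register is measured before each of the queries (each time in a fresh run). -/
noncomputable def expectedQueries (x : Input n M) (i : Fin n) : ℝ :=
  ∑ j : Fin A.queries, queryMass (A.stateAfter x j (j.2.trans (Nat.lt_succ_self _))) i

theorem expectedQueries_nonneg (x : Input n M) (i : Fin n) : 0 ≤ A.expectedQueries x i :=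
  Finset.sum_nonneg fun _ _ => queryMass_nonneg _ _

theorem sum_expectedQueries_le (x : Input n M) : ∑ i, A.expectedQueries x i ≤ A.queries := by
  simp only [expectedQueries]
  rw [Finset.sum_comm]
  refine (Finset.sum_le_card_nsmul _ _ 1 fun j _ => ?_).trans_eq (by simp)
  exact (sum_queryMass_le _).trans_eq (by rw [ampNorm_stateAfter, one_pow])

theorem ampNorm_stateAfter_sub_le (x y : Input n M) (k : ℕ) (hk : k < A.queries + 1) :
    ampNorm (A.stateAfter x k hk - A.stateAfter y k hk) ≤
      ∑ j : Fin k, 2 * √(∑ i ∈ diffSet x y, queryMass (A.stateAfter x j (j.2.trans hk)) i) := by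
  induction k with
  | zero => simp [stateAfter, ampNorm]
  | succ k ih =>
    rw [stateAfter, stateAfter, ← Matrix.mulVec_sub, ampNorm_mulVec_unitary,
      Fin.sum_univ_castSucc, add_comm]
    refine (ampNorm_sub_le _ (oracle y (A.stateAfter x k (Nat.lt_of_succ_lt hk))) _).trans ?_
    refine add_le_add (ampNorm_oracle_sub_oracle_le x y _) ?_
    rw [← oracle_sub, ampNorm_oracle]
    exact ih _

theorem abs_outputProb_sub_le (x y : Input n M) (b : Bool) :
    |A.outputProb x b - A.outputProb y b| ≤
      4 * √(A.queries * ∑ i ∈ diffSet x y, A.expectedQueries x i) := by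
  set m : Fin A.queries → ℝ := fun j =>
    ∑ i ∈ diffSet x y, queryMass (A.stateAfter x j (j.2.trans (Nat.lt_succ_self _))) i
  have hm (j : Fin A.queries) : 0 ≤ m j := Finset.sum_nonneg fun _ _ => queryMass_nonneg _ _
  have hdist := A.ampNorm_stateAfter_sub_le x y _ (Nat.lt_succ_self _)
  have hprob := abs_sum_sq_sub_sum_sq_le (A.stateAfter x _ (Nat.lt_succ_self _))
    (A.stateAfter y _ (Nat.lt_succ_self _)) {s | A.out s = b}
  rw [ampNorm_stateAfter, ampNorm_stateAfter, ← outputProb_eq_sum_filter,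
    ← outputProb_eq_sum_filter] at hprob
  have hsqrt : ∑ j, √(m j) ≤ √(A.queries * ∑ j, m j) := by
    refine Real.le_sqrt_of_sq_le (sq_sum_le_card_mul_sum_sq.trans_eq ?_)
    simp only [Real.sq_sqrt (hm _), Finset.card_univ, Fintype.card_fin]
  rw [← Finset.mul_sum] at hdist
  simp only [expectedQueries]
  rw [Finset.sum_comm]
  linarith

end QuantumAlgorithm

theorem QuantumComputable.nonempty_queryWeights {n M : ℕ} {X : Set (Input n M)} {f : X → Bool}
    {q : ℕ} (h : QuantumComputable f q) :
    Nonempty (QueryWeights (Subtype.val : X → Input n M) f (2304 * q ^ 2)) := by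
  obtain ⟨A, rfl, hA⟩ := h
  -- `2304 = 48²`, so that weight below `1` forces `4 * √(…) < 4 / 48 = 1 / 12`.
  exact ⟨{
    p := fun x => A.outputProb x true
    w := fun x i => 2304 * A.queries * A.expectedQueries x i
    nonneg := fun x i => mul_nonneg (by positivity) (A.expectedQueries_nonneg x i)
    sum_le := fun x => by
      rw [← Finset.mul_sum]
      calc 2304 * (A.queries : ℝ) * ∑ i, A.expectedQueries x i
          ≤ 2304 * (A.queries : ℝ) * A.queries := by
            gcongr
            exact A.sum_expectedQueries_le x
        _ = ((2304 * A.queries ^ 2 : ℕ) : ℝ) := by push_cast; ring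
    stable := fun x y hxy => by
      rw [← Finset.mul_sum] at hxy
      have hsqrt : √(A.queries * ∑ i ∈ diffSet x y, A.expectedQueries x i) < 1 / 48 := by
        rw [Real.sqrt_lt' (by norm_num)]
        linarith
      linarith [A.abs_outputProb_sub_le x y true]
    separated := fun x y hxy => le_abs_sub_of_abs_sub_boole_le hxy
      ((A.abs_outputProb_sub_boole x (f x)).trans_le (hA x))
      ((A.abs_outputProb_sub_boole y (f y)).trans_le (hA y)) }⟩

/-! ### Complexity bounds -/

section Complexity

variable {n M : ℕ} {T : Set (Input n M)} {f : T → Bool} {q : ℕ}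

theorem DetComputable.toENNReal_detComplexity_le (h : DetComputable f q) :
    (detComplexity f : ℝ≥0∞) ≤ q := by
  exact_mod_cast ENat.toENNReal_le.mpr (iInf₂_le q h : detComplexity f ≤ q)

theorem RandComputable.toENNReal_detComplexity_le (hT : IsTypePromise T) (h : RandComputable f q) :
    (detComplexity f : ℝ≥0∞) ≤ 3450 * 12 ^ 6 * q ^ 6 := by
  obtain ⟨H⟩ := h.nonempty_queryWeights
  refine (H.detComputable hT).toENNReal_detComplexity_le.trans_eq ?_
  push_cast
  ring

theorem QuantumComputable.toENNReal_detComplexity_le (hT : IsTypePromise T)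
    (h : QuantumComputable f q) :
    (detComplexity f : ℝ≥0∞) ≤ 3450 * 2304 ^ 6 * q ^ 12 := by
  obtain ⟨H⟩ := h.nonempty_queryWeights
  refine (H.detComputable hT).toENNReal_detComplexity_le.trans_eq ?_
  push_cast
  ring

end Complexity

theorem inv_mul_rpow_le_of_le_mul_rpow {a b B : ℝ≥0∞} {r : ℝ} (hr : 1 ≤ r) (hB : 1 ≤ B)
    (hB_top : B ≠ ∞) (h : a ≤ B * b ^ r) : B⁻¹ * a ^ (1 / r) ≤ b := by
  rw [ENNReal.inv_mul_le_iff (zero_lt_one.trans_le hB).ne' hB_top,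
    one_div,
    ENNReal.rpow_inv_le_iff (by positivity), ENNReal.mul_rpow_of_nonneg _ _ (by positivity)]
  refine h.trans ?_
  gcongr
  exact (ENNReal.rpow_one B).symm.trans_le (ENNReal.rpow_le_rpow_of_exponent_le hB hr)

end QueryComplexity

theorem mainTheorem1 :
    ∃ c : ℝ≥0, 0 < c ∧
      ∀ (n M : ℕ) (T : Set (QueryComplexity.Input n M)),
        QueryComplexity.IsTypePromise T →
        ∀ f : T → Bool,
          (c : ℝ≥0∞) * (QueryComplexity.detComplexity f : ℝ≥0∞) ^ (1 / 6 : ℝ)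
              ≤ (QueryComplexity.randComplexity f : ℝ≥0∞) ∧
          (c : ℝ≥0∞) * (QueryComplexity.detComplexity f : ℝ≥0∞) ^ (1 / 12 : ℝ)
              ≤ (QueryComplexity.quantumComplexity f : ℝ≥0∞) := by
  refine ⟨(3450 * 2304 ^ 6)⁻¹, by positivity, fun n M T hT f => ⟨?_, ?_⟩⟩
  · rw [ENNReal.coe_inv (by positivity), QueryComplexity.randComplexity]
    simp only [ENat.toENNReal_iInf, ENat.toENNReal_coe]
    refine le_iInf₂ fun q hq => QueryComplexity.inv_mul_rpow_le_of_le_mul_rpow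
      (by norm_num) (by norm_cast) ENNReal.coe_ne_top ?_
    refine (hq.toENNReal_detComplexity_le hT).trans ?_
    rw [ENNReal.rpow_ofNat]
    push_cast
    gcongr
    norm_num
  · rw [ENNReal.coe_inv (by positivity), QueryComplexity.quantumComplexity]
    simp only [ENat.toENNReal_iInf, ENat.toENNReal_coe]
    refine le_iInf₂ fun q hq => QueryComplexity.inv_mul_rpow_le_of_le_mul_rpow
      (by norm_num) (by norm_cast) ENNReal.coe_ne_top ?_
    rw [ENNReal.rpow_ofNat]
    push_cast
    exact hq.toENNReal_detComplexity_le hT
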